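/- Let $R$ be a commutative ring with identity and let $C$ be a semidualizing $R$-module, i.e. $C$ has a resolution by finitely generated projective $R$-modules, the homothety map $R\to\operatorname{Hom}_R(C,C)$ is an isomorphism, and $\operatorname{Ext}_R^{n}(C,C)=0$ for all $n\ge 1$. An $R$-module is called $C$-projective (resp. $C$-flat) if it is isomorphic to $C\otimes_R P$ with $P$ a projective (resp. flat) $R$-module. An $R$-module $M$ is called $D_C$-projective if there is an exact sequence of $R$-modules $$\cdots\to L^1\xrightarrow{\delta^1} L^0\xrightarrow{\delta^0} L^{-1}\xrightarrow{\delta^{-1}} L^{-2}\to\cdots$$ which remains exact after applying $\operatorname{Hom}_R(-,F)$ for every $C$-flat $R$-module $F$, with $L^i$ projective for all $i\ge 0$ and $L^i$ $C$-projective for all $i<0$, such that $M\cong\operatorname{Im}\delta^0$. A complex $H$ of $R$-modules is called $C$-flat if it is exact and each cycle module $Z_i(H)=\operatorname{Ker}(H^i\to H^{i-1})$, $i\in\mathbb{Z}$, is $C$-flat. Let $X$ be a ($\mathbb{Z}$-indexed) complex of $R$-modules. If $X$ is exact and $Z_i(X)$ is $D_C$-projective for every $i\in\mathbb{Z}$,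 then $\operatorname{Ext}^1(X,H)=0$ for every $C$-flat complex $H$, where $\operatorname{Ext}^1$ is taken in the abelian category $\operatorname{Ch}(R)$ of complexes of $R$-modules. -/

import Mathlib

open CategoryTheory CategoryTheory.Limits
open scoped TensorProduct

universe u

namespace DingComplex

variable {R : Type u} [CommRing R]

/-- An `R`-module `C` is semidualizing. -/
structure IsSemidualizing (C : ModuleCat.{u} R) : Prop where
  /-- `C` has a resolution by finitely generated projective modules. -/
  exists_resolution : ∃ P : ProjectiveResolution C, ∀ n : ℕ, Module.Finite R (P.complex.X n)
  /-- The homothety map `R → Hom_R(C, C)`, `r ↦ (c ↦ r • c)`, is an isomorphism. -/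
  homothety_bijective : Function.Bijective (LinearMap.lsmul R C : R →ₗ[R] (C →ₗ[R] C))
  /-- `Ext^n(C, C) = 0` for all `n ≥ 1`. -/
  ext_self : ∀ n : ℕ, 1 ≤ n → Subsingleton (Abelian.Ext C C n)

/-- `M` is `C`-projective: `M ≅ C ⊗ P` with `P` projective. -/
def IsCProjective (C M : ModuleCat.{u} R) : Prop :=
  ∃ P : ModuleCat.{u} R, Module.Projective R P ∧ Nonempty (M ≃ₗ[R] C ⊗[R] P)

/-- `M` is `C`-flat: `M ≅ C ⊗ F` with `F` flat. -/
def IsCFlat (C M : ModuleCat.{u} R) : Prop :=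
  ∃ F : ModuleCat.{u} R, Module.Flat R F ∧ Nonempty (M ≃ₗ[R] C ⊗[R] F)

/-- The sequence of abelian groups obtained by applying `Hom(-, N)` to the complex `L` is exact. -/
def HomExact (L : ChainComplex (ModuleCat.{u} R) ℤ) (N : ModuleCat.{u} R) : Prop :=
  ∀ i : ℤ, Function.Exact
    (fun f : L.X (i - 1) ⟶ N => L.d i (i - 1) ≫ f)
    (fun g : L.X i ⟶ N => L.d (i + 1) i ≫ g)

/-- `M` is `D_C`-projective: it is isomorphic to the image of `L 0 → L (-1)` for an exact,
`Hom(-, C-flat)`-exact complex `L` which is projective in degrees `≥ 0` and `C`-projective in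
degrees `< 0`. -/
def IsDCProjective (C M : ModuleCat.{u} R) : Prop :=
  ∃ L : ChainComplex (ModuleCat.{u} R) ℤ,
    L.Acyclic ∧
    (∀ F : ModuleCat.{u} R, IsCFlat C F → HomExact L F) ∧
    (∀ i : ℤ, 0 ≤ i → Module.Projective R (L.X i)) ∧
    (∀ i : ℤ, i < 0 → IsCProjective C (L.X i)) ∧
    Nonempty (M ≃ₗ[R] LinearMap.range (L.d 0 (-1)).hom)

/-- Given a class `P` of modules, `X` is a `P`-complex: `X` is exact and all its cycle modules
`Z_i(X) = Ker (X i → X (i - 1))` belong to `P`. -/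
def IsClassComplex (P : ModuleCat.{u} R → Prop) (X : ChainComplex (ModuleCat.{u} R) ℤ) : Prop :=
  X.Acyclic ∧ ∀ i : ℤ, P (X.cycles i)

/-- `H` is a `C`-flat complex. -/
def IsCFlatComplex (C : ModuleCat.{u} R) (H : ChainComplex (ModuleCat.{u} R) ℤ) : Prop :=
  IsClassComplex (IsCFlat C) H

end DingComplex

/-!
Let `0 ⟶ H ⟶ E ⟶ X ⟶ 0` be an extension of exact complexes. Taking cycles gives extensions of
`Z_i(X)` by `Z_i(H)`, which split since `Ext¹(Z_i(X), Z_i(H)) = 0`. To extend such splittings to a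
chain map, regard `X_i` and `E_i` as extensions of `Z_{i-1}` by `Z_i`. As
`Ext¹(Z_{i-1}(X), Z_i(H)) = 0`, the map
`Ext¹(Z_{i-1}(X), Z_i(E)) ⟶ Ext¹(Z_{i-1}(X), Z_i(X))` is injective, so the splittings on `Z_i` and
`Z_{i-1}` are compatible with the two extension classes and come from a map `X_i ⟶ E_i`. Correcting
it by a map `X_i ⟶ Z_{i-1}(X) ⟶ Z_i(X) ⟶ E_i` turns it into a section of `E_i ⟶ X_i`.
-/

namespace DingComplex

section Extensions

variable {𝒜 : Type*} [Category 𝒜] [Abelian 𝒜]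

lemma shortExact_pullback {S : ShortComplex 𝒜} (hS : S.ShortExact) {A : 𝒜} (φ : A ⟶ S.X₃) :
    (ShortComplex.mk (pullback.lift 0 S.f (by simp)) (pullback.fst φ S.g)
      (pullback.lift_fst _ _ _)).ShortExact := by
  have := hS.mono_f
  have := hS.epi_g
  have hf : pullback.lift 0 S.f (by simp) ≫ pullback.snd φ S.g = S.f := pullback.lift_snd _ _ _
  have : Mono (pullback.lift (0 : S.X₁ ⟶ A) S.f (by simp) : _ ⟶ pullback φ S.g) :=
    mono_of_mono_fac hf
  refine { exact := ShortComplex.exact_of_f_is_kernel _ ?_ }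
  exact KernelFork.IsLimit.ofι' _ _ fun {T} (k : T ⟶ pullback φ S.g)
      (hk : k ≫ pullback.fst φ S.g = 0) ↦
    ⟨hS.exact.lift (k ≫ pullback.snd φ S.g)
      (by rw [Category.assoc, ← pullback.condition, reassoc_of% hk, zero_comp]),
      pullback.hom_ext
        (by rw [Category.assoc, pullback.lift_fst, comp_zero, hk])
        (by rw [Category.assoc, pullback.lift_snd, ShortComplex.Exact.lift_f])⟩

variable [HasExt 𝒜]

lemma exists_comp_g_eq_iff {S : ShortComplex 𝒜} (hS : S.ShortExact) {A : 𝒜} (φ : A ⟶ S.X₃) :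
    (∃ ψ, ψ ≫ S.g = φ) ↔ (Abelian.Ext.mk₀ φ).comp hS.extClass (zero_add 1) = 0 := by
  refine ⟨?_, fun hφ ↦ ?_⟩
  · rintro ⟨ψ, rfl⟩
    rw [← Abelian.Ext.mk₀_comp_mk₀, Abelian.Ext.comp_assoc_of_second_deg_zero, hS.comp_extClass,
      Abelian.Ext.comp_zero]
  · obtain ⟨x, hx⟩ := Abelian.Ext.covariant_sequence_exact₃ A hS _ (zero_add 1) hφ
    obtain ⟨ψ, rfl⟩ := (Abelian.Ext.mk₀_bijective _ _).surjective x
    exact ⟨ψ, (Abelian.Ext.mk₀_bijective _ _).injective (by simpa using hx)⟩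

lemma exists_f_comp_eq_iff {S : ShortComplex 𝒜} (hS : S.ShortExact) {B : 𝒜} (φ : S.X₁ ⟶ B) :
    (∃ ψ, S.f ≫ ψ = φ) ↔ hS.extClass.comp (Abelian.Ext.mk₀ φ) (add_zero 1) = 0 := by
  refine ⟨?_, fun hφ ↦ ?_⟩
  · rintro ⟨ψ, rfl⟩
    rw [← Abelian.Ext.mk₀_comp_mk₀, hS.extClass_comp_assoc]
  · obtain ⟨x, hx⟩ := Abelian.Ext.contravariant_sequence_exact₁ hS B _ (add_zero 1) hφ
    obtain ⟨ψ, rfl⟩ := (Abelian.Ext.mk₀_bijective _ _).surjective x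
    exact ⟨ψ, (Abelian.Ext.mk₀_bijective _ _).injective (by simpa using hx)⟩

lemma subsingleton_ext_one_of_projective {S : ShortComplex 𝒜} (hS : S.ShortExact)
    [Projective S.X₂] {B : 𝒜} (h : ∀ φ : S.X₁ ⟶ B, ∃ ψ, S.f ≫ ψ = φ) :
    Subsingleton (Abelian.Ext S.X₃ B 1) := by
  refine subsingleton_of_forall_eq 0 fun x ↦ ?_
  obtain ⟨y, rfl⟩ := Abelian.Ext.contravariant_sequence_exact₃ hS B x
    (Abelian.Ext.eq_zero_of_projective _) (add_zero 1)
  obtain ⟨φ, rfl⟩ := (Abelian.Ext.mk₀_bijective _ _).surjective y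
  exact (exists_f_comp_eq_iff hS φ).1 (h φ)

lemma postcomp_injective_of_subsingleton {S : ShortComplex 𝒜} (hS : S.ShortExact) {A : 𝒜} {n : ℕ}
    (hA : Subsingleton (Abelian.Ext A S.X₁ n)) :
    Function.Injective ((Abelian.Ext.mk₀ S.g).postcomp A (add_zero n)) := by
  refine (injective_iff_map_eq_zero _).2 fun x hx ↦ ?_
  obtain ⟨y, rfl⟩ := Abelian.Ext.covariant_sequence_exact₂ A hS x hx
  rw [Subsingleton.elim y 0, Abelian.Ext.zero_comp]

lemma exists_hom_of_extClass_comp_eq {S T : ShortComplex 𝒜} (hS : S.ShortExact)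
    (hT : T.ShortExact) (f₁ : S.X₁ ⟶ T.X₁) (f₃ : S.X₃ ⟶ T.X₃)
    (h : hS.extClass.comp (Abelian.Ext.mk₀ f₁) (add_zero 1) =
      (Abelian.Ext.mk₀ f₃).comp hT.extClass (zero_add 1)) :
    ∃ φ : S ⟶ T, φ.τ₁ = f₁ ∧ φ.τ₃ = f₃ := by
  obtain ⟨ρ, hρ⟩ : ∃ ρ, S.f ≫ ρ = f₁ ≫ T.f := by
    rw [exists_f_comp_eq_iff hS, ← Abelian.Ext.mk₀_comp_mk₀,
      ← Abelian.Ext.comp_assoc_of_second_deg_zero, h,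
      Abelian.Ext.comp_assoc_of_third_deg_zero, hT.extClass_comp, Abelian.Ext.comp_zero]
  have := hS.epi_g
  obtain ⟨v, hv⟩ := hS.exact.desc' (ρ ≫ T.g) (by rw [reassoc_of% hρ, T.zero, comp_zero])
  have hfv : (Abelian.Ext.mk₀ (f₃ - v)).comp hT.extClass (zero_add 1) = 0 := by
    rw [sub_eq_add_neg, Abelian.Ext.mk₀_add, Abelian.Ext.mk₀_neg, Abelian.Ext.add_comp,
      Abelian.Ext.neg_comp, ← h, ← sub_eq_add_neg, sub_eq_zero]
    exact hS.extClass_naturality hT (ShortComplex.homMk f₁ ρ v hρ.symm hv.symm)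
  obtain ⟨w, hw⟩ := (exists_comp_g_eq_iff hT _).2 hfv
  exact ⟨ShortComplex.homMk f₁ (ρ + S.g ≫ w) f₃ (by simp [hρ]) (by simp [hw, hv]), rfl, rfl⟩

lemma exists_section_of_sections {S T : ShortComplex 𝒜} (hS : S.ShortExact)
    (hT : T.ShortExact) (p : T ⟶ S)
    (hp : Function.Injective ((Abelian.Ext.mk₀ p.τ₁).postcomp S.X₃ (add_zero 1)))
    (s₁ : S.X₁ ⟶ T.X₁) (hs₁ : s₁ ≫ p.τ₁ = 𝟙 _) (s₃ : S.X₃ ⟶ T.X₃) (hs₃ : s₃ ≫ p.τ₃ = 𝟙 _) :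
    ∃ s : S ⟶ T, s.τ₁ = s₁ ∧ s.τ₃ = s₃ ∧ s ≫ p = 𝟙 S := by
  have hclass : hS.extClass.comp (Abelian.Ext.mk₀ s₁) (add_zero 1) =
      (Abelian.Ext.mk₀ s₃).comp hT.extClass (zero_add 1) := hp <| by
    simp only [Abelian.Ext.postcomp, AddMonoidHom.flip_apply, Abelian.Ext.bilinearComp_apply_apply]
    rw [Abelian.Ext.comp_assoc_of_third_deg_zero, Abelian.Ext.mk₀_comp_mk₀, hs₁,
      Abelian.Ext.comp_mk₀_id, Abelian.Ext.comp_assoc_of_third_deg_zero,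
      hT.extClass_naturality hS p, Abelian.Ext.mk₀_comp_mk₀_assoc, hs₃, Abelian.Ext.mk₀_id_comp]
  obtain ⟨φ, rfl, rfl⟩ := exists_hom_of_extClass_comp_eq hS hT s₁ s₃ hclass
  have := hS.epi_g
  have := hS.mono_f
  have hφ₁ : S.f ≫ φ.τ₂ ≫ p.τ₂ = S.f := by simp [← φ.comm₁₂_assoc, ← p.comm₁₂, reassoc_of% hs₁]
  have hφ₃ : φ.τ₂ ≫ p.τ₂ ≫ S.g = S.g := by simp [p.comm₂₃, φ.comm₂₃_assoc, hs₃]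
  -- `φ ≫ p` and `𝟙 S` agree on both ends, so they differ by a map factoring as
  -- `S.X₂ ⟶ S.X₃ ⟶ S.X₁ ⟶ S.X₂`; its lift along `p` through `φ.τ₁` is subtracted from `φ`.
  obtain ⟨v, hv⟩ := hS.exact.desc' (φ.τ₂ ≫ p.τ₂ - 𝟙 _) (by simp [hφ₁])
  obtain ⟨u, rfl⟩ := hS.exact.lift' v
    (by simp [← cancel_epi S.g, reassoc_of% hv, hφ₃])
  refine ⟨ShortComplex.homMk φ.τ₁ (φ.τ₂ - S.g ≫ u ≫ φ.τ₁ ≫ T.f) φ.τ₃ (by simp [φ.comm₁₂])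
    (by simp [φ.comm₂₃]), rfl, rfl, ?_⟩
  ext
  · exact hs₁
  · simp [← p.comm₁₂, reassoc_of% hs₁, hv]
  · exact hs₃

lemma subsingleton_ext_one_of_forall_section [EnoughInjectives 𝒜] {A B : 𝒜}
    (h : ∀ ⦃E : 𝒜⦄ (f : B ⟶ E) (g : E ⟶ A) (w : f ≫ g = 0), (ShortComplex.mk f g w).ShortExact →
      ∃ s, s ≫ g = 𝟙 A) :
    Subsingleton (Abelian.Ext A B 1) := by
  refine subsingleton_of_forall_eq 0 fun x ↦ ?_
  let S := ShortComplex.mk _ _ (cokernel.condition (Injective.ι B))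
  have hS : S.ShortExact := { exact := ShortComplex.exact_cokernel _ }
  obtain ⟨y, rfl⟩ := Abelian.Ext.covariant_sequence_exact₁ A hS x
    (Abelian.Ext.eq_zero_of_injective _) (zero_add 1)
  obtain ⟨φ, rfl⟩ := (Abelian.Ext.mk₀_bijective _ _).surjective y
  obtain ⟨s, hs⟩ := h _ _ _ (shortExact_pullback hS φ)
  refine (exists_comp_g_eq_iff hS φ).1 ⟨s ≫ pullback.snd φ S.g, ?_⟩
  rw [Category.assoc, ← pullback.condition, reassoc_of% hs]

end Extensions

section Complexes

variable {𝒜 ι : Type*} [Category 𝒜] [Abelian 𝒜] {c : ComplexShape ι}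

lemma shortExact_iCycles_of_fac (K : HomologicalComplex 𝒜 c) {i j : ι} (hij : c.Rel i j) {Q : 𝒜}
    (q : K.X i ⟶ Q) (m : Q ⟶ K.X j) [Epi q] [Mono m] (fac : q ≫ m = K.d i j) :
    (ShortComplex.mk (K.iCycles i) q (by simp [← cancel_mono m, fac])).ShortExact where
  exact := ShortComplex.exact_of_f_is_kernel _ (KernelFork.IsLimit.ofι' _ _ fun k hk ↦
    ⟨K.liftCycles k j (c.next_eq' hij) (by rw [← fac, reassoc_of% hk, zero_comp]),
      K.liftCycles_i _ _ _ _⟩)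

lemma epi_toCycles_of_exactAt {K : HomologicalComplex 𝒜 c} {i j : ι} (hij : c.prev j = i)
    (hj : K.ExactAt j) : Epi (K.toCycles i j) := by
  subst hij
  exact ShortComplex.Exact.epi_toCycles hj

/-- For a complex `K` exact at `j`, with `i` preceding `j`, this is the short exact sequence
`0 ⟶ Z_i(K) ⟶ K_i ⟶ Z_j(K) ⟶ 0`. -/
@[simps]
noncomputable def cyclesSequence (K : HomologicalComplex 𝒜 c) (i j : ι) : ShortComplex 𝒜 where
  f := K.iCycles i
  g := K.toCycles i j
  zero := by simp [← cancel_mono (K.iCycles j)]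

lemma cyclesSequence_shortExact {K : HomologicalComplex 𝒜 c} {i j : ι} (hij : c.Rel i j)
    (hj : K.ExactAt j) : (cyclesSequence K i j).ShortExact :=
  have := epi_toCycles_of_exactAt (c.prev_eq' hij) hj
  shortExact_iCycles_of_fac K hij _ (K.iCycles j) (K.toCycles_i i j)

/-- The morphism of cycle sequences induced by a morphism of complexes. -/
@[simps]
noncomputable def cyclesSequenceMap {K L : HomologicalComplex 𝒜 c} (φ : K ⟶ L) (i j : ι) :
    cyclesSequence K i j ⟶ cyclesSequence L i j where
  τ₁ := HomologicalComplex.cyclesMap φ i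
  τ₂ := φ.f i
  τ₃ := HomologicalComplex.cyclesMap φ j
  comm₁₂ := HomologicalComplex.cyclesMap_i φ i
  comm₂₃ := by
    change φ.f i ≫ L.toCycles i j = K.toCycles i j ≫ HomologicalComplex.cyclesMap φ j
    simp [← cancel_mono (L.iCycles j)]

lemma shortExact_cyclesMap {S : ShortComplex (HomologicalComplex 𝒜 c)} (hS : S.ShortExact) {i : ι}
    (hi : S.X₃.ExactAt i) :
    (S.map (HomologicalComplex.cyclesFunctor 𝒜 c i)).ShortExact := by
  have := hS.mono_f
  have := hS.epi_g
  have := epi_toCycles_of_exactAt rfl hi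
  have hg : S.g.f (c.prev i) ≫ S.X₃.toCycles (c.prev i) i =
      S.X₂.toCycles (c.prev i) i ≫ HomologicalComplex.cyclesMap S.g i :=
    (cyclesSequenceMap S.g (c.prev i) i).comm₂₃
  have : Epi (HomologicalComplex.cyclesMap S.g i) := epi_of_epi_fac hg.symm
  exact
    { exact := HomologicalComplex.cycles_left_exact S hS.exact i
      mono_f := inferInstanceAs (Mono (HomologicalComplex.cyclesMap S.f i))
      epi_g := this }

variable [HasExt 𝒜]

lemma subsingleton_ext_one_of_hom_exact {K : HomologicalComplex 𝒜 c} {h i j k : ι}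
    (hij : c.Rel i j) (hjk : c.Rel j k) (hj : K.ExactAt j) [Projective (K.X j)] {F Q : 𝒜}
    (hF : ∀ f : K.X i ⟶ F, K.d h i ≫ f = 0 → ∃ g, K.d i j ≫ g = f)
    (q : K.X j ⟶ Q) (m : Q ⟶ K.X k) [Epi q] [Mono m] (fac : q ≫ m = K.d j k) :
    Subsingleton (Abelian.Ext Q F 1) := by
  refine subsingleton_ext_one_of_projective (shortExact_iCycles_of_fac K hjk q m fac) fun φ ↦ ?_
  have := epi_toCycles_of_exactAt (c.prev_eq' hij) hj
  obtain ⟨ψ, hψ⟩ := hF (K.toCycles i j ≫ φ) (by simp)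
  exact ⟨ψ, by simpa [← cancel_epi (K.toCycles i j)] using hψ⟩

lemma exists_section_cyclesMap {S : ShortComplex (HomologicalComplex 𝒜 c)} (hS : S.ShortExact)
    {i : ι} (hi : S.X₃.ExactAt i)
    (hExt : Subsingleton (Abelian.Ext (S.X₃.cycles i) (S.X₁.cycles i) 1)) :
    ∃ τ, τ ≫ HomologicalComplex.cyclesMap S.g i = 𝟙 _ :=
  (exists_comp_g_eq_iff (shortExact_cyclesMap hS hi) (𝟙 _)).2 (hExt.elim _ _)

lemma exists_section_f {S : ShortComplex (HomologicalComplex 𝒜 c)} (hS : S.ShortExact)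
    (h₁ : S.X₁.Acyclic) (h₃ : S.X₃.Acyclic)
    (hExt : ∀ i j, c.Rel i j → Subsingleton (Abelian.Ext (S.X₃.cycles j) (S.X₁.cycles i) 1))
    (τ : ∀ i, S.X₃.cycles i ⟶ S.X₂.cycles i)
    (hτ : ∀ i, τ i ≫ HomologicalComplex.cyclesMap S.g i = 𝟙 _) (i : ι) :
    ∃ σ : S.X₃.X i ⟶ S.X₂.X i, σ ≫ S.g.f i = 𝟙 _ ∧
      S.X₃.iCycles i ≫ σ = τ i ≫ S.X₂.iCycles i ∧
      ∀ j, c.Rel i j → σ ≫ S.X₂.toCycles i j = S.X₃.toCycles i j ≫ τ j := by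
  by_cases! hi : ∃ j, c.Rel i j
  · obtain ⟨j, hij⟩ := hi
    obtain ⟨s, hs₁, hs₃, hs⟩ := exists_section_of_sections (cyclesSequence_shortExact hij (h₃ j))
      (cyclesSequence_shortExact hij (hS.acyclic_X₂ h₁ h₃ j)) (cyclesSequenceMap S.g i j)
      (postcomp_injective_of_subsingleton (shortExact_cyclesMap hS (h₃ i)) (hExt i j hij))
      (τ i) (hτ i) (τ j) (hτ j)
    refine ⟨s.τ₂, congr(($hs).τ₂), hs₁ ▸ s.comm₁₂.symm, fun j' hij' ↦ ?_⟩
    obtain rfl := c.next_eq hij hij'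
    exact hs₃ ▸ s.comm₂₃
  · have := S.X₃.isIso_iCycles i _ rfl (S.X₃.shape _ _ (hi _))
    exact ⟨inv (S.X₃.iCycles i) ≫ τ i ≫ S.X₂.iCycles i,
      by simp [← HomologicalComplex.cyclesMap_i, reassoc_of% hτ i],
      by simp, fun j hij ↦ (hi j hij).elim⟩

lemma exists_section_of_acyclic {S : ShortComplex (HomologicalComplex 𝒜 c)} (hS : S.ShortExact)
    (h₁ : S.X₁.Acyclic) (h₃ : S.X₃.Acyclic)
    (hExt : ∀ i, Subsingleton (Abelian.Ext (S.X₃.cycles i) (S.X₁.cycles i) 1))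
    (hExt' : ∀ i j, c.Rel i j → Subsingleton (Abelian.Ext (S.X₃.cycles j) (S.X₁.cycles i) 1)) :
    ∃ s, s ≫ S.g = 𝟙 S.X₃ := by
  choose τ hτ using fun i ↦ exists_section_cyclesMap hS (h₃ i) (hExt i)
  choose σ hσ hσi hστ using exists_section_f hS h₁ h₃ hExt' τ hτ
  refine ⟨{ f := σ, comm' := fun i j hij ↦ ?_ }, by ext i; exact hσ i⟩
  rw [← S.X₂.toCycles_i, reassoc_of% hστ i j hij, ← hσi, S.X₃.toCycles_i_assoc]

theorem subsingleton_ext_one_of_acyclic [EnoughInjectives (HomologicalComplex 𝒜 c)]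
    [HasExt (HomologicalComplex 𝒜 c)] {X H : HomologicalComplex 𝒜 c}
    (hX : X.Acyclic) (hH : H.Acyclic)
    (h : ∀ i, Subsingleton (Abelian.Ext (X.cycles i) (H.cycles i) 1))
    (h' : ∀ i j, c.Rel i j → Subsingleton (Abelian.Ext (X.cycles j) (H.cycles i) 1)) :
    Subsingleton (Abelian.Ext X H 1) :=
  subsingleton_ext_one_of_forall_section fun _ _ _ _ hE ↦
    exists_section_of_acyclic hE hH hX h h'

end Complexes

lemma IsDCProjective.subsingleton_ext_one {R : Type u} [CommRing R] {C M F : ModuleCat.{u} R}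
    (hM : IsDCProjective C M) (hF : IsCFlat C F) : Subsingleton (Abelian.Ext M F 1) := by
  obtain ⟨L, hL, hHom, hproj, -, ⟨e⟩⟩ := hM
  have : Projective (L.X 0) := (IsProjective.iff_projective _).1 (hproj 0 le_rfl)
  let q := ModuleCat.ofHom (L.d 0 (-1)).hom.rangeRestrict ≫ e.toModuleIso.inv
  let m := e.toModuleIso.hom ≫ ModuleCat.ofHom (LinearMap.range (L.d 0 (-1)).hom).subtype
  have : Epi (ModuleCat.ofHom (L.d 0 (-1)).hom.rangeRestrict) :=
    (ModuleCat.epi_iff_surjective _).2 (LinearMap.surjective_rangeRestrict _)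
  have : Mono (ModuleCat.ofHom (LinearMap.range (L.d 0 (-1)).hom).subtype) :=
    (ModuleCat.mono_iff_injective _).2 Subtype.val_injective
  exact subsingleton_ext_one_of_hom_exact (h := 2) (i := 1) (by simp) (by simp) (hL 0)
    (fun f hf ↦ (hHom F hF 1 f).1 hf) q m (by ext; simp [q, m])

end DingComplex

theorem proposition2p5_general {R : Type u} [CommRing R] (C : ModuleCat.{u} R)
    (X : ChainComplex (ModuleCat.{u} R) ℤ) (hX : X.Acyclic)
    (hZ : ∀ i : ℤ, DingComplex.IsDCProjective C (X.cycles i))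
    (H : ChainComplex (ModuleCat.{u} R) ℤ) (hH : DingComplex.IsCFlatComplex C H) :
    Subsingleton (Abelian.Ext X H 1) :=
  DingComplex.subsingleton_ext_one_of_acyclic hX hH.1 (fun i ↦ (hZ i).subsingleton_ext_one (hH.2 i))
    fun i j _ ↦ (hZ j).subsingleton_ext_one (hH.2 i)

theorem proposition2p5 {R : Type u} [CommRing R]
    (C : ModuleCat.{u} R) (hC : DingComplex.IsSemidualizing C)
    (X : ChainComplex (ModuleCat.{u} R) ℤ)
    (hX : X.Acyclic)
    (hZ : ∀ i : ℤ, DingComplex.IsDCProjective C (X.cycles i))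
    (H : ChainComplex (ModuleCat.{u} R) ℤ) (hH : DingComplex.IsCFlatComplex C H) :
    Subsingleton (Abelian.Ext X H 1) :=
  proposition2p5_general C X hX hZ H hH
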